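/- Let $\mathbf k$ be a field of characteristic zero; all tensor products are over $\mathbf k$. For $\mathbf k[\partial]$-modules $U,V,W$, a conformal bilinear map is a $\mathbf k$-bilinear map $f_\lambda:U\times V\to W[\lambda]$ with $f_\lambda(\partial u,v)=-\lambda f_\lambda(u,v)$ and $f_\lambda(u,\partial v)=(\lambda+\partial)f_\lambda(u,v)$. A Leibniz conformal algebra is a $\mathbf k[\partial]$-module $L$ with a conformal bilinear map $[\cdot_\lambda\cdot]:L\times L\to L[\lambda]$ such that $[a_\lambda[b_\mu c]]=[[a_\lambda b]_{\lambda+\mu}c]+[b_\mu[a_\lambda c]]$ for all $a,b,c\in L$. A Leibniz-dendriform conformal algebra (LDCA) is a $\mathbf k[\partial]$-module $Q$ with two conformal bilinear maps $\lhd_\lambda,\rhd_\lambda:Q\times Q\to Q[\lambda]$ such that for all $a,b,c\in Q$ \begin{align*} a\rhd_\lambda(b\rhd_\mu c+b\lhd_\mu c)&=(a\rhd_\lambda b)\rhd_{\lambda+\mu}c+b\lhd_\mu(a\rhd_\lambda c),\\ a\lhd_\lambda(b\rhd_\mu c)&=(a\lhd_\lambda b)\rhd_{\lambda+\mu}c+b\rhd_\mu(a\rhd_\lambda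 c+a\lhd_\lambda c),\\ a\lhd_\lambda(b\lhd_\mu c)&=(a\rhd_\lambda b+a\lhd_\lambda b)\lhd_{\lambda+\mu}c+b\lhd_\mu(a\lhd_\lambda c). \end{align*} The conformal dual of $Q$ is the space $Q^{*c}$ of $\mathbf k$-linear maps $f:Q\to\mathbf k[\lambda]$, $u\mapsto\langle f,u\rangle_\lambda$, with $\langle f,\partial u\rangle_\lambda=\lambda\langle f,u\rangle_\lambda$; it is a $\mathbf k[\partial]$-module by $\langle\partial f,u\rangle_\lambda=-\lambda\langle f,u\rangle_\lambda$. If $Q$ is a finitely generated $\mathbf k[\partial]$-module and $l_\lambda:Q\times Q\to Q[\lambda]$, $(a,v)\mapsto l(a)_\lambda v$, is a conformal bilinear map, then $l^*(a)_\lambda f\in Q^{*c}[\lambda]$ is determined by $\langle l^*(a)_\lambda f,v\rangle_\mu=-\langle f,l(a)_\lambda v\rangle_{\mu-\lambda}$. For a Leibniz conformal algebra $L$ and $r=\sum_i a_i\otimes b_i\in L\otimes L$ put $$[[r,r]]=\sum_{i,j}\Big([{a_i}_\mu a_j]\otimes b_i\otimes b_j\big|_{\mu=\partial_2}+a_i\otimes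 a_j\otimes[{b_j}_\mu b_i]\big|_{\mu=\partial_2}-a_i\otimes[{b_i}_\mu a_j]\otimes b_j\big|_{\mu=\partial_1}-a_i\otimes[{a_j}_\mu b_i]\otimes b_j\big|_{\mu=-\partial_1-\partial_2}\Big),$$ where $\partial_s$ is the action of $\partial$ on the $s$-th factor of $L\otimes L\otimes L$. Then $r$ is a solution of the classical Leibniz conformal Yang--Baxter equation (CLCYBE) in $L$ if $[[r,r]]\in(\partial_1+\partial_2+\partial_3)(L\otimes L\otimes L)$. **Theorem.** Let $(Q,\lhd_\lambda,\rhd_\lambda)$ be an LDCA that is free of finite rank over $\mathbf k[\partial]$, with $\mathbf k[\partial]$-basis $\{a^i\}_{i=1}^n$, and let $\{a_i\}_{i=1}^n$ be the dual $\mathbf k[\partial]$-basis of $Q^{*c}$, that is, $\langle a_i,a^j\rangle_\lambda=\delta_{ij}$. Put $[a_\lambda b]=a\rhd_\lambda b+a\lhd_\lambda b$, $l_\lhd(a)_\lambda b=a\lhd_\lambda b$ and $r_\rhd(a)_\lambda b=b\rhd_{-\lambda-\partial}a$. Then $Q\oplus Q^{*c}$ with the $\lambda$-bracket $$[(a+x)_\lambda(b+y)]=[a_\lambda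 b]+l_\lhd^*(a)_\lambda y-(l_\lhd^*+r_\rhd^*)(b)_{-\lambda-\partial}x\qquad(a,b\in Q,\ x,y\in Q^{*c})$$ is a Leibniz conformal algebra, denoted by $Q\ltimes_{l_\lhd^*,-l_\lhd^*-r_\rhd^*}Q^{*c}$, and $$r=\sum_{i=1}^n(a_i\otimes a^i+a^i\otimes a_i)$$ is a symmetric solution of the CLCYBE in it. -/

import Mathlib

open scoped TensorProduct Polynomial

noncomputable section

set_option linter.unusedSectionVars false
set_option linter.unusedSimpArgs false

namespace LeibnizConformal

/-- The action of `∂` on a `k[∂]`-module `M`; here `k[∂]` is Mathlib's `k[X]` with `∂ = X`. -/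
def del (k : Type*) [Field k] (M : Type*) [AddCommGroup M] [Module k M] [Module k[X] M]
    [IsScalarTower k k[X] M] : Module.End k M where
  toFun m := (Polynomial.X : k[X]) • m
  map_add' := smul_add _
  map_smul' c m := by
    simp only [RingHom.id_apply, ← algebraMap_smul k[X] c m,
      ← algebraMap_smul k[X] c ((Polynomial.X : k[X]) • m), smul_smul, mul_comm]

section Polynomials

variable {k : Type*} [Field k] {M W : Type*} [AddCommGroup M] [Module k M]
  [AddCommGroup W] [Module k W]

/-- `M[λ]` is `ℕ →₀ M`, a finitely supported `m` standing for `∑ λⁿ mₙ`.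
For `m ∈ M[λ]`, a linear map `g : M → W` and an endomorphism `φ` of `W` this is
`∑ φⁿ (g mₙ)`: apply `g` to the coefficients and substitute `φ` for `λ`. -/
def subst (φ : Module.End k W) (g : M →ₗ[k] W) : (ℕ →₀ M) →ₗ[k] W :=
  Finsupp.lsum k fun n => (φ ^ n) ∘ₗ g

@[simp] lemma subst_single (φ : Module.End k W) (g : M →ₗ[k] W) (n : ℕ) (m : M) :
    subst φ g (Finsupp.single n m) = (φ ^ n) (g m) := by
  simp [subst]

lemma subst_apply (φ : Module.End k W) (g : M →ₗ[k] W) (p : ℕ →₀ M) :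
    subst φ g p = p.sum fun n m => (φ ^ n) (g m) := rfl

lemma subst_add (φ : Module.End k W) (g h : M →ₗ[k] W) :
    subst φ (g + h) = subst φ g + subst φ h := by
  ext; simp

lemma subst_smul (φ : Module.End k W) (c : k) (g : M →ₗ[k] W) :
    subst φ (c • g) = c • subst φ g := by
  ext; simp

variable (k M) in
/-- Multiplication by the variable on `M[λ]`: `∑ λⁿ mₙ ↦ ∑ λⁿ⁺¹ mₙ`. -/
def mulVar : Module.End k (ℕ →₀ M) := Finsupp.lmapDomain M k Nat.succ

@[simp] lemma mulVar_single (n : ℕ) (m : M) :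
    mulVar k M (Finsupp.single n m) = Finsupp.single (n + 1) m := by
  simp [mulVar]

lemma mulVar_apply_zero (p : ℕ →₀ M) : mulVar k M p 0 = 0 := by
  induction p using Finsupp.induction_linear with
  | zero => simp
  | add f g hf hg => simp [map_add, hf, hg]
  | single n m => simp

lemma mulVar_apply_succ (p : ℕ →₀ M) (n : ℕ) : mulVar k M p (n + 1) = p n := by
  induction p using Finsupp.induction_linear with
  | zero => simp
  | add f g hf hg => simp [map_add, hf, hg]
  | single n m => simp [Finsupp.single_apply]

variable (k M) in
/-- `M[λ, μ]`, as polynomials in `μ` with coefficients in `M[λ]`: multiplication by `λ`. -/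
def mulLam : Module.End k (ℕ →₀ ℕ →₀ M) := Finsupp.mapRange.linearMap (mulVar k M)

variable (k M) in
/-- Multiplication by `μ` on `M[λ, μ]`. -/
def mulMu : Module.End k (ℕ →₀ ℕ →₀ M) := mulVar k (ℕ →₀ M)

variable (k M) in
/-- The inclusion of `M` into `M[λ, μ]` as constants. -/
def const₂ : M →ₗ[k] (ℕ →₀ ℕ →₀ M) := Finsupp.lsingle 0 ∘ₗ Finsupp.lsingle 0

/-- Rename the variable of an element of `M[ν]`: substitute `φ` (such as `λ`, `μ` or `λ + μ`)
for `ν`, with values in `M[λ, μ]`. -/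
def evalAt (φ : Module.End k (ℕ →₀ ℕ →₀ M)) : (ℕ →₀ M) →ₗ[k] (ℕ →₀ ℕ →₀ M) :=
  subst φ (const₂ k M)

variable [Module k[X] M] [IsScalarTower k k[X] M]

variable (k M) in
/-- The substitution `λ ↦ -λ-∂` on `M[λ]`. -/
def skew : Module.End k (ℕ →₀ M) :=
  subst (-mulVar k M - del k (ℕ →₀ M)) (Finsupp.lsingle 0)

end Polynomials

/-- A conformal bilinear map from `U × V` to `W`: a `k`-bilinear map `f_λ : U × V → W[λ]`
with `f_λ(∂u, v) = -λ f_λ(u, v)` and `f_λ(u, ∂v) = (λ + ∂) f_λ(u, v)`. For `V = W` this is the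
same as a `k[∂]`-module homomorphism from `U` to `Cend(V)`. -/
structure ConformalBilin (k : Type*) [Field k] (U V W : Type*)
    [AddCommGroup U] [Module k U] [Module k[X] U] [IsScalarTower k k[X] U]
    [AddCommGroup V] [Module k V] [Module k[X] V] [IsScalarTower k k[X] V]
    [AddCommGroup W] [Module k W] [Module k[X] W] [IsScalarTower k k[X] W] where
  toLin : U →ₗ[k] V →ₗ[k] (ℕ →₀ W)
  del_left : ∀ u v, toLin (del k U u) v = -mulVar k W (toLin u v)
  del_right : ∀ u v, toLin u (del k V v) =
    mulVar k W (toLin u v) + del k (ℕ →₀ W) (toLin u v)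

section Products

variable {k : Type*} [Field k] {Q : Type*} [AddCommGroup Q] [Module k Q] [Module k[X] Q]
  [IsScalarTower k k[X] Q] {M : Type*} [AddCommGroup M] [Module k M] [Module k[X] M]
  [IsScalarTower k k[X] M]

lemma skew_mulVar (p : ℕ →₀ M) :
    skew k M (mulVar k M p) = -mulVar k M (skew k M p) - del k (ℕ →₀ M) (skew k M p) := by
  induction p using Finsupp.induction_linear with
  | zero => simp
  | add f g hf hg => simp only [map_add, hf, hg]; abel
  | single n m =>
    simp only [skew, mulVar_single, subst_single, pow_succ', Module.End.mul_apply,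
      LinearMap.sub_apply, LinearMap.neg_apply]

lemma mulVar_del (p : ℕ →₀ M) :
    mulVar k M (del k (ℕ →₀ M) p) = del k (ℕ →₀ M) (mulVar k M p) := by
  induction p using Finsupp.induction_linear with
  | zero => simp
  | add f g hf hg => simp only [map_add, hf, hg]
  | single n m => simp [del, Finsupp.smul_single]

lemma skew_del (p : ℕ →₀ M) :
    skew k M (del k (ℕ →₀ M) p) = del k (ℕ →₀ M) (skew k M p) := by
  have hc : Commute (-mulVar k M - del k (ℕ →₀ M)) (del k (ℕ →₀ M)) := by
    refine LinearMap.ext fun x => ?_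
    simp only [Module.End.mul_apply, LinearMap.sub_apply, LinearMap.neg_apply, map_sub, map_neg,
      mulVar_del (k := k) (M := M) x]
  induction p using Finsupp.induction_linear with
  | zero => simp
  | add f g hf hg => simp only [map_add, hf, hg]
  | single n m =>
    have h1 : del k (ℕ →₀ M) (Finsupp.single n m) = Finsupp.single n (del k M m) := by
      simp [del, Finsupp.smul_single]
    have h2 : (Finsupp.lsingle 0 : M →ₗ[k] (ℕ →₀ M)) (del k M m)
        = del k (ℕ →₀ M) ((Finsupp.lsingle 0 : M →ₗ[k] (ℕ →₀ M)) m) := by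
      simp [del, Finsupp.smul_single]
    rw [h1, skew, subst_single, subst_single, h2, ← Module.End.mul_apply, (hc.pow_left n).eq,
      Module.End.mul_apply]

namespace ConformalBilin

instance : Add (ConformalBilin k Q M M) where
  add f g :=
    { toLin := f.toLin + g.toLin
      del_left := fun u v => by simp [f.del_left, g.del_left]; abel
      del_right := fun u v => by simp [f.del_right, g.del_right]; abel }

instance : Neg (ConformalBilin k Q M M) where
  neg f :=
    { toLin := -f.toLin
      del_left := fun u v => by simp [f.del_left]
      del_right := fun u v => by simp [f.del_right]; abel }

/-- From a `λ`-product `b ⋆_λ a`, the right multiplication `R(a)_λ b = b ⋆_{-λ-∂} a`. -/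
def rightMul (f : ConformalBilin k Q Q Q) : ConformalBilin k Q Q Q where
  toLin := f.toLin.flip.compr₂ (skew k Q)
  del_left u v := by
    simp only [LinearMap.compr₂_apply, LinearMap.flip_apply, f.del_right, map_add, skew_mulVar,
      skew_del]
    abel
  del_right u v := by
    simp only [LinearMap.compr₂_apply, LinearMap.flip_apply, f.del_left, map_neg, skew_mulVar]
    abel

/-- `a f_λ (b g_μ c)`. -/
def nestR (f g : ConformalBilin k Q Q Q) (a b c : Q) : ℕ →₀ ℕ →₀ Q :=
  subst (mulMu k Q) (evalAt (mulLam k Q) ∘ₗ f.toLin a) (g.toLin b c)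

/-- `(a f_λ b) g_{λ+μ} c`. -/
def nestL (f g : ConformalBilin k Q Q Q) (a b c : Q) : ℕ →₀ ℕ →₀ Q :=
  subst (mulLam k Q) (evalAt (mulLam k Q + mulMu k Q) ∘ₗ g.toLin.flip c) (f.toLin a b)

/-- `b g_μ (a f_λ c)`. -/
def nestS (g f : ConformalBilin k Q Q Q) (b a c : Q) : ℕ →₀ ℕ →₀ Q :=
  subst (mulLam k Q) (evalAt (mulMu k Q) ∘ₗ g.toLin b) (f.toLin a c)

/-- A `λ`-bracket (conformal sesquilinearity is part of `ConformalBilin`) makes `Q` a Leibniz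
conformal algebra: `[a_λ [b_μ c]] = [[a_λ b]_{λ+μ} c] + [b_μ [a_λ c]]`. -/
def IsLeibniz (br : ConformalBilin k Q Q Q) : Prop :=
  ∀ a b c : Q, nestR br br a b c = nestL br br a b c + nestS br br b a c

end ConformalBilin

end Products

/-- A Leibniz-dendriform conformal algebra structure on the `k[∂]`-module `Q`. -/
structure LDCA (k : Type*) [Field k] (Q : Type*) [AddCommGroup Q] [Module k Q] [Module k[X] Q]
    [IsScalarTower k k[X] Q] where
  /-- `a ◁_λ b` -/
  lhd : ConformalBilin k Q Q Q
  /-- `a ▷_λ b` -/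
  rhd : ConformalBilin k Q Q Q
  /-- `a ▷_λ (b ▷_μ c + b ◁_μ c) = (a ▷_λ b) ▷_{λ+μ} c + b ◁_μ (a ▷_λ c)` -/
  rhd_add : ∀ a b c, rhd.nestR (rhd + lhd) a b c = rhd.nestL rhd a b c + lhd.nestS rhd b a c
  /-- `a ◁_λ (b ▷_μ c) = (a ◁_λ b) ▷_{λ+μ} c + b ▷_μ (a ▷_λ c + a ◁_λ c)` -/
  lhd_rhd : ∀ a b c, lhd.nestR rhd a b c = lhd.nestL rhd a b c + rhd.nestS (rhd + lhd) b a c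
  /-- `a ◁_λ (b ◁_μ c) = (a ▷_λ b + a ◁_λ b) ◁_{λ+μ} c + b ◁_μ (a ◁_λ c)` -/
  lhd_lhd : ∀ a b c, lhd.nestR lhd a b c = (rhd + lhd).nestL lhd a b c + lhd.nestS lhd b a c

section Dual

variable (k : Type*) [Field k] (M : Type*) [AddCommGroup M] [Module k M] [Module k[X] M]
  [IsScalarTower k k[X] M]

/-- The `k`-linear maps `f : M → k[λ]` with `f_λ(∂u) = λ f_λ(u)`, as a `k`-subspace. -/
def conformalDualSubmodule : Submodule k (M →ₗ[k] k[X]) where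
  carrier := {f | ∀ u, f (del k M u) = Polynomial.X * f u}
  add_mem' hf hg u := by simp [hf u, hg u, mul_add]
  zero_mem' u := by simp
  smul_mem' c f hf u := by simp [hf u]

/-- The conformal dual `M^{*c} = Chom(M, k)`. -/
def ConformalDual : Type _ := conformalDualSubmodule k M

instance : AddCommGroup (ConformalDual k M) :=
  inferInstanceAs (AddCommGroup (conformalDualSubmodule k M))

instance : Module k (ConformalDual k M) :=
  inferInstanceAs (Module k (conformalDualSubmodule k M))

variable {M}

/-- The pairing `⟨f, u⟩_λ = f_λ(u) ∈ k[λ]` of `f ∈ M^{*c}` with `u ∈ M`. -/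
def pair : ConformalDual k M →ₗ[k] M →ₗ[k] k[X] := (conformalDualSubmodule k M).subtype

lemma pair_del (f : ConformalDual k M) (u : M) :
    pair k f (del k M u) = Polynomial.X * pair k f u := f.2 u

variable {k} in
lemma ConformalDual.ext {f g : ConformalDual k M} (h : ∀ u, pair k f u = pair k g u) : f = g :=
  Subtype.ext (LinearMap.ext h)

/-- An element of the conformal dual from a linear map. -/
def ConformalDual.mk (f : M →ₗ[k] k[X]) (hf : ∀ u, f (del k M u) = Polynomial.X * f u) :
    ConformalDual k M := ⟨f, hf⟩

@[simp] lemma pair_mk (f : M →ₗ[k] k[X]) (hf : ∀ u, f (del k M u) = Polynomial.X * f u) (u : M) :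
    pair k (ConformalDual.mk k f hf) u = f u := rfl

variable (M)

/-- The action of `∂` on the conformal dual: `(∂ f)_λ u = -λ f_λ u`. -/
def dualDel : Module.End k (ConformalDual k M) where
  toFun f := ConformalDual.mk k (LinearMap.mulLeft k (-Polynomial.X) ∘ₗ pair k f) fun u => by
    simp only [LinearMap.comp_apply, LinearMap.mulLeft_apply, pair_del]; ring
  map_add' f g := ConformalDual.ext fun u => by simp [mul_add]
  map_smul' c f := ConformalDual.ext fun u => by simp

/-- The `k[∂]`-module structure of the conformal dual, `∂` acting by `dualDel`. -/
instance : Module k[X] (ConformalDual k M) :=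
  Module.compHom (ConformalDual k M) (Polynomial.aeval (dualDel k M)).toRingHom

variable {M} in
lemma poly_smul_def (p : k[X]) (f : ConformalDual k M) :
    p • f = Polynomial.aeval (dualDel k M) p f := rfl

instance : IsScalarTower k k[X] (ConformalDual k M) where
  smul_assoc c p f := by simp [poly_smul_def]

lemma del_conformalDual : del k (ConformalDual k M) = dualDel k M := by
  ext1 f
  simp [del, poly_smul_def]


variable {k M}

lemma pair_poly_smul (p : k[X]) (f : ConformalDual k M) (u : M) :
    pair k (p • f) u = p.comp (-Polynomial.X) * pair k f u := by
  induction p using Polynomial.induction_on' with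
  | add p q hp hq => simp [add_smul, hp, hq, add_mul]
  | monomial n c =>
    induction n generalizing f with
    | zero =>
      rw [Polynomial.monomial_zero_left, ← Polynomial.algebraMap_eq, algebraMap_smul]
      simp [Polynomial.smul_eq_C_mul]
    | succ n ih =>
      have h : (Polynomial.X : k[X]) • f = dualDel k M f := by
        rw [← del_conformalDual]; rfl
      rw [← Polynomial.monomial_mul_X, mul_smul, h, ih]
      simp [dualDel, mul_assoc, pow_succ]

lemma apply_poly_smul (f : M →ₗ[k] k[X]) (hf : ∀ u, f (del k M u) = Polynomial.X * f u)
    (p : k[X]) (u : M) : f (p • u) = p * f u := by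
  induction p using Polynomial.induction_on' with
  | add p q hp hq => simp [add_smul, hp, hq, add_mul]
  | monomial n c =>
    induction n generalizing u with
    | zero =>
      rw [Polynomial.monomial_zero_left, ← Polynomial.algebraMap_eq, algebraMap_smul]
      simp [Polynomial.smul_eq_C_mul]
    | succ n ih =>
      rw [← Polynomial.monomial_mul_X, mul_smul, ih]
      have h : (Polynomial.X : k[X]) • u = del k M u := rfl
      rw [h, hf, mul_assoc]

/-- Coordinates on the conformal dual with respect to the dual of a `k[∂]`-basis of `M`. -/
def dualCoords {ι : Type*} [Fintype ι] (b : Module.Basis ι k[X] M) :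
    ConformalDual k M ≃ₗ[k[X]] (ι → k[X]) where
  toFun f i := (pair k f (b i)).comp (-Polynomial.X)
  map_add' f g := by ext1 i; simp
  map_smul' p f := by
    ext1 i
    simp [pair_poly_smul, Polynomial.mul_comp, Polynomial.comp_assoc]
  invFun g := ConformalDual.mk k
    ((b.constr k[X] fun i => (g i).comp (-Polynomial.X)).restrictScalars k) fun u =>
      (b.constr k[X] fun i => (g i).comp (-Polynomial.X)).map_smul Polynomial.X u
  left_inv f := by
    refine ConformalDual.ext fun u => ?_
    refine Eq.trans (b.constr_apply_fintype k[X] _ u) ?_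
    conv_rhs => rw [← b.sum_equivFun u, map_sum]
    refine Finset.sum_congr rfl fun i _ => ?_
    rw [apply_poly_smul _ (pair_del k f)]
    simp [Polynomial.comp_assoc]
  right_inv g := by
    ext1 i
    refine Eq.trans (congrArg (fun p : k[X] => p.comp (-Polynomial.X))
      (b.constr_basis k[X] (fun i => (g i).comp (-Polynomial.X)) i)) ?_
    simp [Polynomial.comp_assoc]

/-- The dual `k[∂]`-basis `(a_i)` of `M^{*c}` of a `k[∂]`-basis `(a^i)` of `M`. -/
def dualBasis {ι : Type*} [Fintype ι] (b : Module.Basis ι k[X] M) :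
    Module.Basis ι k[X] (ConformalDual k M) := Module.Basis.ofEquivFun (dualCoords b)

/-- `(a_i)_λ a^j = δ_{ij}`. -/
lemma pair_dualBasis {ι : Type*} [Fintype ι] [DecidableEq ι] (b : Module.Basis ι k[X] M)
    (i j : ι) : pair k (dualBasis b i) (b j) = if i = j then 1 else 0 := by
  have h := congrFun ((dualCoords b).apply_symm_apply (Pi.single i (1 : k[X]))) j
  have h' : (pair k (dualBasis b i) (b j)).comp (-Polynomial.X) =
      (Pi.single i (1 : k[X]) : ι → k[X]) j := by
    have e : dualBasis b i = (dualCoords b).symm (Pi.single i 1) := by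
      rw [dualBasis, Module.Basis.coe_ofEquivFun]
    rw [e]
    exact h
  have h2 := congrArg (fun p : k[X] => p.comp (-Polynomial.X)) h'
  simp only [Polynomial.comp_assoc, Polynomial.neg_comp, Polynomial.X_comp, neg_neg,
    Polynomial.comp_X] at h2
  rw [h2]
  by_cases hij : i = j
  · subst hij; simp
  · rw [Pi.single_eq_of_ne' hij]; simp [hij]

/-- `⟨f, p⟩_{μ-λ} ∈ k[λ, μ]` for `f ∈ M^{*c}` and `p = ∑ λⁿ pₙ ∈ M[λ]`, that is
`∑ λⁿ f_{μ-λ}(pₙ)`. An element of `k[λ, μ]` is a polynomial in `λ = X` with coefficients in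
`k[μ]`, so that `μ = C X`. -/
def shiftPair (f : ConformalDual k M) : (ℕ →₀ M) →ₗ[k] k[X][X] :=
  subst (LinearMap.mulLeft k (Polynomial.X : k[X][X]))
    ((Polynomial.aeval (Polynomial.C Polynomial.X - Polynomial.X : k[X][X])).toLinearMap ∘ₗ
      pair k f)

lemma shiftPair_mulVar (f : ConformalDual k M) (p : ℕ →₀ M) :
    shiftPair f (mulVar k M p) = Polynomial.X * shiftPair f p := by
  induction p using Finsupp.induction_linear with
  | zero => simp
  | add f g hf hg => simp only [map_add, hf, hg, mul_add]
  | single n m =>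
    simp only [shiftPair, mulVar_single, subst_single, pow_succ', Module.End.mul_apply,
      LinearMap.mulLeft_apply]

lemma shiftPair_del (f : ConformalDual k M) (p : ℕ →₀ M) :
    shiftPair f (del k (ℕ →₀ M) p) =
      (Polynomial.C Polynomial.X - Polynomial.X) * shiftPair f p := by
  induction p using Finsupp.induction_linear with
  | zero => simp
  | add f g hf hg => simp only [map_add, hf, hg, mul_add]
  | single n m =>
    have h1 : del k (ℕ →₀ M) (Finsupp.single n m) = Finsupp.single n (del k M m) := by
      simp [del, Finsupp.smul_single]
    rw [h1]
    simp only [shiftPair, subst_single, LinearMap.comp_apply, pair_del, LinearMap.pow_mulLeft,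
      LinearMap.mulLeft_apply, AlgHom.toLinearMap_apply, map_mul, Polynomial.aeval_X]
    ring

lemma shiftPair_dualDel (f : ConformalDual k M) (p : ℕ →₀ M) :
    shiftPair (dualDel k M f) p =
      -(Polynomial.C Polynomial.X - Polynomial.X) * shiftPair f p := by
  induction p using Finsupp.induction_linear with
  | zero => simp
  | add f g hf hg => simp only [map_add, hf, hg, mul_add]
  | single n m =>
    simp only [shiftPair, subst_single, LinearMap.comp_apply, LinearMap.pow_mulLeft, dualDel,
      LinearMap.coe_mk, AddHom.coe_mk, pair_mk,
      LinearMap.mulLeft_apply, AlgHom.toLinearMap_apply, map_mul, map_neg, Polynomial.aeval_X]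
    ring

lemma shiftPair_add (f g : ConformalDual k M) : shiftPair (f + g) = shiftPair f + shiftPair g := by
  rw [shiftPair, map_add, LinearMap.comp_add, subst_add]; rfl

lemma shiftPair_smul (c : k) (f : ConformalDual k M) : shiftPair (c • f) = c • shiftPair f := by
  rw [shiftPair, map_smul, LinearMap.comp_smul, subst_smul]; rfl

variable {Q : Type*} [AddCommGroup Q] [Module k Q] [Module k[X] Q] [IsScalarTower k k[X] Q]

/-- The coefficient of `λⁿ` in `v ↦ -⟨f, l(a)_λ v⟩_{μ-λ}`, an element of `M^{*c}`. -/
def dualCoeff (l : ConformalBilin k Q M M) (a : Q) (f : ConformalDual k M) (n : ℕ) :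
    ConformalDual k M :=
  ConformalDual.mk k
    (-((Polynomial.lcoeff k[X] n).restrictScalars k ∘ₗ shiftPair f ∘ₗ l.toLin a)) fun u => by
      simp only [LinearMap.neg_apply, LinearMap.comp_apply, l.del_right, map_add,
        shiftPair_mulVar, shiftPair_del, LinearMap.restrictScalars_apply,
        Polynomial.lcoeff_apply, sub_mul, Polynomial.coeff_sub, Polynomial.coeff_C_mul]
      ring

lemma pair_dualCoeff (l : ConformalBilin k Q M M) (a : Q) (f : ConformalDual k M) (n : ℕ) (v : M) :
    pair k (dualCoeff l a f n) v = -(shiftPair f (l.toLin a v)).coeff n := rfl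

lemma dualCoeff_finite [Module.Finite k[X] M] (l : ConformalBilin k Q M M) (a : Q)
    (f : ConformalDual k M) : (Function.support (dualCoeff l a f)).Finite := by
  obtain ⟨S, hS⟩ := (Module.finite_def (R := k[X]) (M := M)).mp inferInstance
  refine Set.Finite.subset (S.biUnion fun v => (shiftPair f (l.toLin a v)).support).finite_toSet ?_
  intro n hn
  by_contra hcon
  apply hn
  simp only [Finset.coe_biUnion, Set.mem_iUnion, Finset.mem_coe, Polynomial.mem_support_iff,
    not_exists, not_not] at hcon
  refine ConformalDual.ext fun u => ?_
  have hu : u ∈ Submodule.span k[X] (S : Set M) := hS ▸ Submodule.mem_top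
  rw [map_zero, LinearMap.zero_apply]
  induction hu using Submodule.span_induction with
  | mem v hv => rw [pair_dualCoeff, hcon v hv, neg_zero]
  | zero => rw [map_zero]
  | add v w _ _ hv hw => rw [map_add, hv, hw, add_zero]
  | smul p v _ hv => rw [apply_poly_smul _ (pair_del k _), hv, mul_zero]

/-- `l*(a)_λ f ∈ M^{*c}[λ]`, for finitely generated `M`. -/
def dualApply [Module.Finite k[X] M] (l : ConformalBilin k Q M M) (a : Q)
    (f : ConformalDual k M) : ℕ →₀ ConformalDual k M :=
  Finsupp.ofSupportFinite (dualCoeff l a f) (dualCoeff_finite l a f)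

lemma dualApply_apply [Module.Finite k[X] M] (l : ConformalBilin k Q M M) (a : Q)
    (f : ConformalDual k M) (n : ℕ) (v : M) :
    pair k (dualApply l a f n) v = -(shiftPair f (l.toLin a v)).coeff n := rfl

/-- The dual `l*` of a conformal action `l` on a finitely generated `M`, given by
`⟨l*(a)_λ f, v⟩_μ = -⟨f, l(a)_λ v⟩_{μ-λ}`. -/
def ConformalBilin.dual [Module.Finite k[X] M] (l : ConformalBilin k Q M M) :
    ConformalBilin k Q (ConformalDual k M) (ConformalDual k M) where
  toLin := LinearMap.mk₂ k (dualApply l)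
    (fun a a' f => Finsupp.ext fun n => ConformalDual.ext fun v => by
      simp [dualApply_apply]; abel)
    (fun c a f => Finsupp.ext fun n => ConformalDual.ext fun v => by
      simp [dualApply_apply])
    (fun a f f' => Finsupp.ext fun n => ConformalDual.ext fun v => by
      simp [dualApply_apply, shiftPair_add]; abel)
    (fun c a f => Finsupp.ext fun n => ConformalDual.ext fun v => by
      simp [dualApply_apply, shiftPair_smul])
  del_left a f := Finsupp.ext fun n => ConformalDual.ext fun v => by
    cases n with
    | zero => simp [dualApply_apply, l.del_left, shiftPair_mulVar, mulVar_apply_zero]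
    | succ n => simp [dualApply_apply, l.del_left, shiftPair_mulVar, mulVar_apply_succ]
  del_right a f := Finsupp.ext fun n => ConformalDual.ext fun v => by
    have hd : ∀ p : ℕ →₀ ConformalDual k M, ∀ n,
        pair k (del k (ℕ →₀ ConformalDual k M) p n) v = -Polynomial.X * pair k (p n) v := by
      intro p n
      have h : del k (ℕ →₀ ConformalDual k M) p n = del k (ConformalDual k M) (p n) := rfl
      rw [h, del_conformalDual]; rfl
    cases n with
    | zero =>
      simp [hd, dualApply_apply, del_conformalDual, shiftPair_dualDel, mulVar_apply_zero, sub_mul,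
        neg_mul]
    | succ n =>
      simp [hd, dualApply_apply, del_conformalDual, shiftPair_dualDel, mulVar_apply_succ, sub_mul,
        neg_mul]
      abel

/-- `⟨l*(a)_λ f, v⟩_μ = -⟨f, l(a)_λ v⟩_{μ-λ}` in `k[λ, μ]`, compared coefficientwise in `λ`. -/
lemma pair_dual [Module.Finite k[X] M] (l : ConformalBilin k Q M M) (a : Q)
    (f : ConformalDual k M) (n : ℕ) (v : M) :
    pair k (l.dual.toLin a f n) v = -(shiftPair f (l.toLin a v)).coeff n := rfl

end Dual

section Semidirect

variable {k : Type*} [Field k] {Q : Type*} [AddCommGroup Q] [Module k Q] [Module k[X] Q]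
  [IsScalarTower k k[X] Q] {M : Type*} [AddCommGroup M] [Module k M] [Module k[X] M]
  [IsScalarTower k k[X] M]

lemma mapRange_mulVar (g : Q →ₗ[k] M) (p : ℕ →₀ Q) :
    Finsupp.mapRange.linearMap g (mulVar k Q p) =
      mulVar k M (Finsupp.mapRange.linearMap g p) := by
  induction p using Finsupp.induction_linear with
  | zero => simp
  | add f g hf hg => simp only [map_add, hf, hg]
  | single n m => simp

lemma mapRange_del (g : Q →ₗ[k] M) (hg : ∀ x, g (del k Q x) = del k M (g x)) (p : ℕ →₀ Q) :
    Finsupp.mapRange.linearMap g (del k (ℕ →₀ Q) p) =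
      del k (ℕ →₀ M) (Finsupp.mapRange.linearMap g p) :=
  Finsupp.ext fun n => hg (p n)

/-- The `λ`-bracket of the semi-direct product `Q ⋉_{l,r} M`:
`[(a + x)_λ (b + y)] = [a_λ b] + l(a)_λ y + r(b)_{-λ-∂} x` on `Q ⊕ M`. -/
def semidirect (br : ConformalBilin k Q Q Q) (l r : ConformalBilin k Q M M) :
    ConformalBilin k (Q × M) (Q × M) (Q × M) where
  toLin := LinearMap.mk₂ k
    (fun u v => Finsupp.mapRange.linearMap (LinearMap.inl k Q M) (br.toLin u.1 v.1) +
      Finsupp.mapRange.linearMap (LinearMap.inr k Q M)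
        (l.toLin u.1 v.2 + skew k M (r.toLin v.1 u.2)))
    (fun u u' v => by simp only [Prod.fst_add, Prod.snd_add, map_add, LinearMap.add_apply]; abel)
    (fun c u v => by
      simp only [Prod.smul_fst, Prod.smul_snd, map_smul, LinearMap.smul_apply, ← smul_add])
    (fun u v v' => by simp only [Prod.fst_add, Prod.snd_add, map_add, LinearMap.add_apply]; abel)
    (fun c u v => by
      simp only [Prod.smul_fst, Prod.smul_snd, map_smul, LinearMap.smul_apply, ← smul_add])
  del_left u v := by
    have h1 : (del k (Q × M) u).1 = del k Q u.1 := rfl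
    have h2 : (del k (Q × M) u).2 = del k M u.2 := rfl
    simp only [LinearMap.mk₂_apply, h1, h2, br.del_left, l.del_left, r.del_right, map_add,
      skew_mulVar, skew_del, map_neg, map_sub, mapRange_mulVar]
    abel
  del_right u v := by
    have h1 : (del k (Q × M) v).1 = del k Q v.1 := rfl
    have h2 : (del k (Q × M) v).2 = del k M v.2 := rfl
    have h3 : ∀ x, LinearMap.inl k Q M (del k Q x) = del k (Q × M) (LinearMap.inl k Q M x) :=
      fun x => by simp [del]
    have h4 : ∀ x, LinearMap.inr k Q M (del k M x) = del k (Q × M) (LinearMap.inr k Q M x) :=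
      fun x => by simp [del]
    simp only [LinearMap.mk₂_apply, h1, h2, br.del_right, l.del_right, r.del_left, map_add,
      skew_mulVar, map_neg, map_sub, mapRange_mulVar, mapRange_del _ h3, mapRange_del _ h4]
    abel

end Semidirect

section YangBaxter

variable {k : Type*} [Field k] {L : Type*} [AddCommGroup L] [Module k L] [Module k[X] L]
  [IsScalarTower k k[X] L]

variable (k L)

/-- `∂₁ = ∂ ⊗ id ⊗ id` on `L ⊗ L ⊗ L` (all tensor products over `k`). -/
def del₁ : Module.End k (L ⊗[k] (L ⊗[k] L)) := TensorProduct.map (del k L) LinearMap.id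

/-- `∂₂ = id ⊗ ∂ ⊗ id`. -/
def del₂ : Module.End k (L ⊗[k] (L ⊗[k] L)) :=
  TensorProduct.map LinearMap.id (TensorProduct.map (del k L) LinearMap.id)

/-- `∂₃ = id ⊗ id ⊗ ∂`. -/
def del₃ : Module.End k (L ⊗[k] (L ⊗[k] L)) :=
  TensorProduct.map LinearMap.id (TensorProduct.map LinearMap.id (del k L))

variable {k L}

/-- `x ↦ x ⊗ b ⊗ c`. -/
def slot₁ (b c : L) : L →ₗ[k] L ⊗[k] (L ⊗[k] L) := (TensorProduct.mk k L _).flip (b ⊗ₜ c)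

/-- `x ↦ a ⊗ x ⊗ c`. -/
def slot₂ (a c : L) : L →ₗ[k] L ⊗[k] (L ⊗[k] L) :=
  TensorProduct.mk k L _ a ∘ₗ (TensorProduct.mk k L L).flip c

/-- `x ↦ a ⊗ b ⊗ x`. -/
def slot₃ (a b : L) : L →ₗ[k] L ⊗[k] (L ⊗[k] L) :=
  TensorProduct.mk k L _ a ∘ₗ TensorProduct.mk k L L b

/-- The contribution to `[[r, r]]` of the terms `a ⊗ b` (with index `i`) and `a' ⊗ b'`
(with index `j`) of `r`:
`[a_μ a'] ⊗ b ⊗ b' |_{μ=∂₂} + a ⊗ a' ⊗ [b'_μ b] |_{μ=∂₂} - a ⊗ [b_μ a'] ⊗ b' |_{μ=∂₁}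
- a ⊗ [a'_μ b] ⊗ b' |_{μ=-∂₁-∂₂}`. -/
def ybTerm (br : ConformalBilin k L L L) (a b a' b' : L) : L ⊗[k] (L ⊗[k] L) :=
  subst (del₂ k L) (slot₁ b b') (br.toLin a a')
    + subst (del₂ k L) (slot₃ a a') (br.toLin b' b)
    - subst (del₁ k L) (slot₂ a b') (br.toLin b a')
    - subst (-del₁ k L - del₂ k L) (slot₂ a b') (br.toLin a' b)

lemma slot₁_add_left (b b' c : L) : slot₁ (k := k) (b + b') c = slot₁ b c + slot₁ b' c := by
  ext x; simp [slot₁, TensorProduct.add_tmul, TensorProduct.tmul_add]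
lemma slot₁_add_right (b c c' : L) : slot₁ (k := k) b (c + c') = slot₁ b c + slot₁ b c' := by
  ext x; simp [slot₁, TensorProduct.tmul_add]
lemma slot₁_smul_left (r : k) (b c : L) : slot₁ (k := k) (r • b) c = r • slot₁ b c := by
  rw [slot₁, ← TensorProduct.smul_tmul', map_smul]; rfl
lemma slot₁_smul_right (r : k) (b c : L) : slot₁ (k := k) b (r • c) = r • slot₁ b c := by
  ext x; simp [slot₁]
lemma slot₂_add_left (b b' c : L) : slot₂ (k := k) (b + b') c = slot₂ b c + slot₂ b' c := by
  ext x; simp [slot₂, TensorProduct.add_tmul]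
lemma slot₂_add_right (b c c' : L) : slot₂ (k := k) b (c + c') = slot₂ b c + slot₂ b c' := by
  ext x; simp [slot₂, TensorProduct.tmul_add]
lemma slot₂_smul_left (r : k) (b c : L) : slot₂ (k := k) (r • b) c = r • slot₂ b c := by
  ext x; simp [slot₂, TensorProduct.smul_tmul']
lemma slot₂_smul_right (r : k) (b c : L) : slot₂ (k := k) b (r • c) = r • slot₂ b c := by
  ext x; simp [slot₂]
lemma slot₃_add_left (b b' c : L) : slot₃ (k := k) (b + b') c = slot₃ b c + slot₃ b' c := by
  ext x; simp [slot₃, TensorProduct.add_tmul]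
lemma slot₃_add_right (b c c' : L) : slot₃ (k := k) b (c + c') = slot₃ b c + slot₃ b c' := by
  ext x; simp [slot₃, TensorProduct.add_tmul, TensorProduct.tmul_add]
lemma slot₃_smul_left (r : k) (b c : L) : slot₃ (k := k) (r • b) c = r • slot₃ b c := by
  ext x; simp [slot₃, TensorProduct.smul_tmul']
lemma slot₃_smul_right (r : k) (b c : L) : slot₃ (k := k) b (r • c) = r • slot₃ b c := by
  rw [slot₃, map_smul, LinearMap.comp_smul]; rfl

/-- The bilinear extension of `ybTerm` to `(L ⊗ L) × (L ⊗ L)`. -/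
def ybBilin (br : ConformalBilin k L L L) :
    L ⊗[k] L →ₗ[k] L ⊗[k] L →ₗ[k] L ⊗[k] (L ⊗[k] L) :=
  TensorProduct.lift <| LinearMap.mk₂ k
    (fun a b => TensorProduct.lift <| LinearMap.mk₂ k (fun a' b' => ybTerm br a b a' b')
      (fun x y z => by
        simp only [ybTerm, map_add, LinearMap.add_apply, slot₁_add_left, slot₂_add_left,
          slot₃_add_right, subst_add]; abel)
      (fun c x y => by
        simp only [ybTerm, map_smul, LinearMap.smul_apply, slot₁_smul_left, slot₂_smul_left,
          slot₃_smul_right, subst_smul, smul_add, smul_sub])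
      (fun x y z => by
        simp only [ybTerm, map_add, LinearMap.add_apply, slot₁_add_right, slot₂_add_right,
          subst_add]; abel)
      (fun c x y => by
        simp only [ybTerm, map_smul, LinearMap.smul_apply, slot₁_smul_right, slot₂_smul_right,
          subst_smul, smul_add, smul_sub]))
    (fun x y z => TensorProduct.ext' fun a' b' => by
      simp only [TensorProduct.lift.tmul, LinearMap.mk₂_apply, ybTerm, map_add,
        LinearMap.add_apply, slot₂_add_left, slot₃_add_left, subst_add]; abel)
    (fun c x y => TensorProduct.ext' fun a' b' => by
      simp only [TensorProduct.lift.tmul, LinearMap.mk₂_apply, ybTerm, map_smul,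
        LinearMap.smul_apply, slot₂_smul_left, slot₃_smul_left, subst_smul, smul_add, smul_sub])
    (fun x y z => TensorProduct.ext' fun a' b' => by
      simp only [TensorProduct.lift.tmul, LinearMap.mk₂_apply, ybTerm, map_add,
        LinearMap.add_apply, slot₁_add_left, subst_add]; abel)
    (fun c x y => TensorProduct.ext' fun a' b' => by
      simp only [TensorProduct.lift.tmul, LinearMap.mk₂_apply, ybTerm, map_smul,
        LinearMap.smul_apply, slot₁_smul_left, subst_smul, smul_add, smul_sub])

lemma ybBilin_tmul (br : ConformalBilin k L L L) (a b a' b' : L) :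
    ybBilin br (a ⊗ₜ b) (a' ⊗ₜ b') = ybTerm br a b a' b' := rfl

/-- `r ∈ L ⊗ L` solves the classical Leibniz conformal Yang-Baxter equation for the `λ`-bracket
`br`: `[[r, r]] ≡ 0` modulo the image of `∂₁ + ∂₂ + ∂₃` on `L ⊗ L ⊗ L`. -/
def IsCLCYBESolution (br : ConformalBilin k L L L) (r : L ⊗[k] L) : Prop :=
  ybBilin br r r ∈ LinearMap.range (del₁ k L + del₂ k L + del₃ k L)

end YangBaxter

section Construction

variable {k : Type*} [Field k] {Q : Type*} [AddCommGroup Q] [Module k Q] [Module k[X] Q]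
  [IsScalarTower k k[X] Q]

/-- The `λ`-bracket `[a_λ b] = a ▷_λ b + a ◁_λ b` of an LDCA. -/
def LDCA.bracket (A : LDCA k Q) : ConformalBilin k Q Q Q := A.rhd + A.lhd

/-- The `λ`-bracket of `Q ⋉ Q^{*c}` for the representation `(Q^{*c}, l*, -l* - r*)`, where
`l(a)_λ b = a ◁_λ b` and `r(a)_λ b = b ▷_{-λ-∂} a`. -/
def LDCA.semidirectBracket [Module.Finite k[X] Q] (A : LDCA k Q) :
    ConformalBilin k (Q × ConformalDual k Q) (Q × ConformalDual k Q) (Q × ConformalDual k Q) :=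
  semidirect A.bracket A.lhd.dual (-A.lhd.dual + -A.rhd.rightMul.dual)

/-- `r = ∑ᵢ (a_i ⊗ a^i + a^i ⊗ a_i)` for a `k[∂]`-basis `(a^i)` of `Q` and the dual `k[∂]`-basis
`(a_i)` of `Q^{*c}`. -/
def canonicalTensor {ι : Type*} [Fintype ι] (b : Module.Basis ι k[X] Q) :
    (Q × ConformalDual k Q) ⊗[k] (Q × ConformalDual k Q) :=
  ∑ i, (((0, dualBasis b i) : Q × ConformalDual k Q) ⊗ₜ[k] ((b i, 0) : Q × ConformalDual k Q)
    + ((b i, 0) : Q × ConformalDual k Q) ⊗ₜ[k] ((0, dualBasis b i) : Q × ConformalDual k Q))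

end Construction

end LeibnizConformal

end

/-! A field of characteristic zero is infinite, so elements of `M[λ]` and `M[λ, μ]` are determined
by their values at scalars (`eq_of_evalScalar`, `eq_of_evalScalar₂`). Each conformal identity
thereby becomes a family of identities between ordinary bilinear maps. In a functional on which `∂`
acts by a scalar, every substitution such as `λ ↦ -λ-∂` becomes a shift of parameters
(`map_subst_of_semiconj`).

Leibniz identity: the `Q`-component is the sum of the three LDCA axioms. The `Q^{*c}`-component,
paired with `v ∈ Q`, splits into a part for each of the three dual arguments. These follow from the
second and third axioms together with the consequence `(a ▷ b + b ◁ a) ▷ c = 0`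
(`rhd_rhd_add_rhd_lhd_at'`).

CLCYBE: `mem_range_del_of_tripleFun` shows that a tensor lies in the image of `∂₁ + ∂₂ + ∂₃` once
all its coordinates at scalars `s₁, s₂, s₃` with sum zero vanish. The tensor `r` is the Casimir
element of the natural form `dualForm` on `Q ⊕ Q^{*c}`: it is `∑ E_J ⊗ E_{σ J}`, where `σ` exchanges
the two halves of the basis, and the coordinate along `E_J` is pairing with `E_{σ J}`. The
coordinates of `[[r, r]]` are then a four-term combination of values of the form on brackets, which
vanishes because the actions on `Q^{*c}` are dual to the products of `Q`
(`dualForm_semidirectBracket`). -/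

noncomputable section

set_option linter.unusedSectionVars false

namespace LeibnizConformal

/-! ### Evaluation of formal variables at scalars. -/

section Evaluation

variable {k : Type*} [Field k] {M W V : Type*} [AddCommGroup M] [Module k M]
  [AddCommGroup W] [Module k W] [AddCommGroup V] [Module k V]

variable (M) in
/-- Evaluation of `p ∈ M[λ]` at a scalar `λ = s`. -/
def evalScalar (s : k) : (ℕ →₀ M) →ₗ[k] M := subst (s • LinearMap.id) LinearMap.id

@[simp] lemma evalScalar_single (s : k) (n : ℕ) (m : M) :
    evalScalar M s (Finsupp.single n m) = s ^ n • m := by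
  induction n with
  | zero => simp [evalScalar]
  | succ n ih =>
    simp only [evalScalar, subst_single, LinearMap.id_apply] at ih ⊢
    rw [pow_succ', Module.End.mul_apply, ih, pow_succ', mul_smul, LinearMap.smul_apply,
      LinearMap.id_apply]

/-- Substituting an operator on which a linear map acts as a scalar `s` amounts to evaluating
at `s`. -/
lemma map_subst_of_semiconj (φ : Module.End k W) (g : M →ₗ[k] W) (h : W →ₗ[k] V) (s : k)
    (hs : ∀ w, h (φ w) = s • h w) (p : ℕ →₀ M) :
    h (subst φ g p) = h (g (evalScalar M s p)) := by
  induction p using Finsupp.induction_linear with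
  | zero => simp
  | add f g hf hg => simp only [map_add, hf, hg]
  | single n m =>
    rw [subst_single, evalScalar_single, map_smul, map_smul]
    induction n with
    | zero => simp
    | succ n ih => rw [pow_succ', Module.End.mul_apply, hs, ih, pow_succ', mul_smul]

lemma evalScalar_mulVar (s : k) (p : ℕ →₀ M) :
    evalScalar M s (mulVar k M p) = s • evalScalar M s p := by
  induction p using Finsupp.induction_linear with
  | zero => simp
  | add f g hf hg => simp only [map_add, hf, hg, smul_add]
  | single n m => simp [pow_succ', mul_smul]

lemma evalScalar_mapRange (s : k) (g : M →ₗ[k] W) (p : ℕ →₀ M) :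
    evalScalar W s (Finsupp.mapRange.linearMap g p) = g (evalScalar M s p) := by
  induction p using Finsupp.induction_linear with
  | zero => simp
  | add f g hf hg => simp only [map_add, hf, hg]
  | single n m => simp

/-- The polynomial `∑ λⁿ ψ(pₙ)` obtained from `p ∈ M[λ]` by applying `ψ` to its coefficients. -/
def mapPoly {R : Type*} [CommRing R] [Algebra k R] (ψ : M →ₗ[k] R) : (ℕ →₀ M) →ₗ[k] R[X] :=
  Finsupp.lsum k fun n => (Polynomial.monomial n).restrictScalars k ∘ₗ ψ

lemma coeff_mapPoly {R : Type*} [CommRing R] [Algebra k R] (ψ : M →ₗ[k] R) (p : ℕ →₀ M)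
    (n : ℕ) : (mapPoly ψ p).coeff n = ψ (p n) := by
  induction p using Finsupp.induction_linear with
  | zero => simp
  | add f g hf hg => simp only [map_add, Polynomial.coeff_add, hf, hg, Finsupp.add_apply]
  | single m x =>
    simp only [mapPoly, Finsupp.lsum_single, LinearMap.comp_apply,
      LinearMap.restrictScalars_apply, Polynomial.coeff_monomial, Finsupp.single_apply]
    split_ifs <;> simp

lemma eval_mapPoly {R : Type*} [CommRing R] [Algebra k R] (ψ : M →ₗ[k] R) (p : ℕ →₀ M)
    (s : k) : (mapPoly ψ p).eval (algebraMap k R s) = ψ (evalScalar M s p) := by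
  induction p using Finsupp.induction_linear with
  | zero => simp
  | add f g hf hg => simp only [map_add, Polynomial.eval_add, hf, hg]
  | single m x =>
    simp only [mapPoly, Finsupp.lsum_single, LinearMap.comp_apply,
      LinearMap.restrictScalars_apply, Polynomial.eval_monomial, evalScalar_single, map_smul,
      Algebra.smul_def, map_pow, mul_comm]

/-- Linear functionals `ψ` separate the points of a vector space, so the claim reduces to
polynomials over `k`, which are determined by their values because `k` is infinite. -/
lemma eq_of_evalScalar [Infinite k] {p q : ℕ →₀ M}
    (h : ∀ s : k, evalScalar M s p = evalScalar M s q) : p = q := by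
  refine Finsupp.ext fun n => ?_
  rw [← sub_eq_zero, ← Module.forall_dual_apply_eq_zero_iff k]
  intro ψ
  have hp : mapPoly ψ p = mapPoly ψ q := Polynomial.funext fun s => by
    have h1 := eval_mapPoly ψ p s
    have h2 := eval_mapPoly ψ q s
    rw [Algebra.algebraMap_self, RingHom.id_apply] at h1 h2
    rw [h1, h2, h s]
  rw [map_sub, ← coeff_mapPoly, ← coeff_mapPoly, hp, sub_self]

variable (M) in
/-- Evaluation of an element of `M[λ, μ]` at `λ = s`, `μ = t`. -/
def evalScalar₂ (s t : k) : (ℕ →₀ ℕ →₀ M) →ₗ[k] M := evalScalar M s ∘ₗ evalScalar (ℕ →₀ M) t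

lemma evalScalar₂_mulLam (s t : k) (p : ℕ →₀ ℕ →₀ M) :
    evalScalar₂ M s t (mulLam k M p) = s • evalScalar₂ M s t p := by
  simp only [evalScalar₂, mulLam, LinearMap.comp_apply, evalScalar_mapRange, evalScalar_mulVar]

lemma evalScalar₂_mulMu (s t : k) (p : ℕ →₀ ℕ →₀ M) :
    evalScalar₂ M s t (mulMu k M p) = t • evalScalar₂ M s t p := by
  simp only [evalScalar₂, mulMu, LinearMap.comp_apply, evalScalar_mulVar, map_smul]

lemma evalScalar₂_evalAt (s t r : k) (φ : Module.End k (ℕ →₀ ℕ →₀ M))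
    (h : ∀ p, evalScalar₂ M s t (φ p) = r • evalScalar₂ M s t p) (p : ℕ →₀ M) :
    evalScalar₂ M s t (evalAt φ p) = evalScalar M r p := by
  rw [evalAt, map_subst_of_semiconj φ _ _ r h]
  simp [evalScalar₂, const₂]

lemma eq_of_evalScalar₂ [Infinite k] {p q : ℕ →₀ ℕ →₀ M}
    (h : ∀ s t : k, evalScalar₂ M s t p = evalScalar₂ M s t q) : p = q :=
  eq_of_evalScalar fun t => eq_of_evalScalar fun s => h s t

variable [Module k[X] M] [IsScalarTower k k[X] M]

lemma evalScalar_del (s : k) (p : ℕ →₀ M) :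
    evalScalar M s (del k (ℕ →₀ M) p) = del k M (evalScalar M s p) := by
  rw [← evalScalar_mapRange]
  rfl

/-- Under a linear map on which `∂` acts as `t`, the substitution `λ ↦ -λ-∂` is `s ↦ -s-t`. -/
lemma map_evalScalar_skew (h : M →ₗ[k] V) (t : k) (ht : ∀ m, h (del k M m) = t • h m) (s : k)
    (p : ℕ →₀ M) : h (evalScalar M s (skew k M p)) = h (evalScalar M (-s - t) p) := by
  have := map_subst_of_semiconj (-mulVar k M - del k (ℕ →₀ M)) (Finsupp.lsingle 0)
    (h ∘ₗ evalScalar M s) (-s - t) (fun w => by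
      simp only [LinearMap.comp_apply, LinearMap.sub_apply, LinearMap.neg_apply, map_sub, map_neg,
        evalScalar_mulVar, evalScalar_del, ht, map_smul, sub_smul, neg_smul]) p
  simpa [skew] using this

end Evaluation

/-! ### Conformal products and their compositions at scalars. -/

namespace ConformalBilin

variable {k : Type*} [Field k] {Q : Type*} [AddCommGroup Q] [Module k Q] [Module k[X] Q]
  [IsScalarTower k k[X] Q] {U V W : Type*}
  [AddCommGroup U] [Module k U] [Module k[X] U] [IsScalarTower k k[X] U]
  [AddCommGroup V] [Module k V] [Module k[X] V] [IsScalarTower k k[X] V]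
  [AddCommGroup W] [Module k W] [Module k[X] W] [IsScalarTower k k[X] W]

/-- The bilinear map `f_s` at a scalar `s`. -/
def at' (f : ConformalBilin k U V W) (s : k) : U →ₗ[k] V →ₗ[k] W :=
  f.toLin.compr₂ (evalScalar W s)

lemma at'_def (f : ConformalBilin k U V W) (s : k) (u : U) (v : V) :
    f.at' s u v = evalScalar W s (f.toLin u v) := rfl

lemma add_at' (f g : ConformalBilin k U V V) (s : k) (u : U) (v : V) :
    (f + g).at' s u v = f.at' s u v + g.at' s u v :=
  map_add (evalScalar V s) (f.toLin u v) (g.toLin u v)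

lemma neg_at' (f : ConformalBilin k U V V) (s : k) (u : U) (v : V) :
    (-f).at' s u v = -f.at' s u v :=
  map_neg (evalScalar V s) (f.toLin u v)

lemma evalScalar₂_nestR (f g : ConformalBilin k Q Q Q) (a b c : Q) (s t : k) :
    evalScalar₂ Q s t (nestR f g a b c) = f.at' s a (g.at' t b c) := by
  rw [nestR, map_subst_of_semiconj _ _ (evalScalar₂ Q s t) t (evalScalar₂_mulMu s t), LinearMap.comp_apply,
    evalScalar₂_evalAt _ _ s _ (evalScalar₂_mulLam s t)]
  rfl

lemma evalScalar₂_nestL (f g : ConformalBilin k Q Q Q) (a b c : Q) (s t : k) :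
    evalScalar₂ Q s t (nestL f g a b c) = g.at' (s + t) (f.at' s a b) c := by
  rw [nestL, map_subst_of_semiconj _ _ (evalScalar₂ Q s t) s (evalScalar₂_mulLam s t), LinearMap.comp_apply,
    evalScalar₂_evalAt _ _ (s + t) _ fun p => by
      rw [LinearMap.add_apply, map_add, evalScalar₂_mulLam, evalScalar₂_mulMu, add_smul]]
  rfl

lemma evalScalar₂_nestS (g f : ConformalBilin k Q Q Q) (b a c : Q) (s t : k) :
    evalScalar₂ Q s t (nestS g f b a c) = g.at' t b (f.at' s a c) := by
  rw [nestS, map_subst_of_semiconj _ _ (evalScalar₂ Q s t) s (evalScalar₂_mulLam s t), LinearMap.comp_apply,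
    evalScalar₂_evalAt _ _ t _ (evalScalar₂_mulMu s t)]
  rfl

lemma isLeibniz_of_at' [Infinite k] (br : ConformalBilin k Q Q Q)
    (h : ∀ (s t : k) (a b c : Q), br.at' s a (br.at' t b c) =
      br.at' (s + t) (br.at' s a b) c + br.at' t b (br.at' s a c)) : br.IsLeibniz :=
  fun a b c => eq_of_evalScalar₂ fun s t => by
    rw [map_add, evalScalar₂_nestR, evalScalar₂_nestL, evalScalar₂_nestS, h]

end ConformalBilin

/-! ### The LDCA axioms at scalars and two consequences. -/

namespace LDCA

variable {k : Type*} [Field k] {Q : Type*} [AddCommGroup Q] [Module k Q] [Module k[X] Q]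
  [IsScalarTower k k[X] Q] (A : LDCA k Q)

lemma bracket_at' (s : k) (a b : Q) :
    A.bracket.at' s a b = A.rhd.at' s a b + A.lhd.at' s a b :=
  ConformalBilin.add_at' _ _ _ _ _

lemma rhd_bracket_at' (s t : k) (a b c : Q) : A.rhd.at' s a (A.bracket.at' t b c) =
    A.rhd.at' (s + t) (A.rhd.at' s a b) c + A.lhd.at' t b (A.rhd.at' s a c) := by
  have h := congrArg (evalScalar₂ Q s t) (A.rhd_add a b c)
  rwa [map_add, ConformalBilin.evalScalar₂_nestR, ConformalBilin.evalScalar₂_nestL,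
    ConformalBilin.evalScalar₂_nestS] at h

lemma lhd_rhd_at' (s t : k) (a b c : Q) : A.lhd.at' s a (A.rhd.at' t b c) =
    A.rhd.at' (s + t) (A.lhd.at' s a b) c + A.rhd.at' t b (A.bracket.at' s a c) := by
  have h := congrArg (evalScalar₂ Q s t) (A.lhd_rhd a b c)
  rwa [map_add, ConformalBilin.evalScalar₂_nestR, ConformalBilin.evalScalar₂_nestL,
    ConformalBilin.evalScalar₂_nestS] at h

lemma lhd_lhd_at' (s t : k) (a b c : Q) : A.lhd.at' s a (A.lhd.at' t b c) =
    A.lhd.at' (s + t) (A.bracket.at' s a b) c + A.lhd.at' t b (A.lhd.at' s a c) := by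
  have h := congrArg (evalScalar₂ Q s t) (A.lhd_lhd a b c)
  rwa [map_add, ConformalBilin.evalScalar₂_nestR, ConformalBilin.evalScalar₂_nestL,
    ConformalBilin.evalScalar₂_nestS] at h

/-- Expanding the last term of the first axiom, `b ◁ (a ▷ c)`, by the second axiom reproduces the
left-hand side `a ▷ [b, c]`. After cancellation only these two terms survive. -/
lemma rhd_rhd_add_rhd_lhd_at' (s t : k) (a b c : Q) :
    A.rhd.at' (s + t) (A.rhd.at' s a b) c + A.rhd.at' (s + t) (A.lhd.at' t b a) c = 0 := by
  have h := A.rhd_bracket_at' s t a b c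
  rw [A.lhd_rhd_at' t s b a c, add_comm t s, ← add_assoc] at h
  exact (right_eq_add.mp h)

/-- The three axioms expand `a ▷ [b, c]`, `a ◁ (b ▷ c)` and `a ◁ (b ◁ c)`, whose sum is `[a, [b,
c]]`. -/
lemma bracket_bracket_at' (s t : k) (a b c : Q) :
    A.bracket.at' s a (A.bracket.at' t b c) = A.bracket.at' (s + t) (A.bracket.at' s a b) c +
      A.bracket.at' t b (A.bracket.at' s a c) := by
  rw [bracket_at' A s a (A.bracket.at' t b c), rhd_bracket_at', bracket_at' A t b c, map_add,
    lhd_rhd_at' A s t a b c, lhd_lhd_at']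
  simp only [bracket_at', map_add, LinearMap.add_apply]
  abel

end LDCA

/-! ### The pairing and the dual action at scalars. -/

section DualEvaluation

variable {k : Type*} [Field k] {M : Type*} [AddCommGroup M] [Module k M] [Module k[X] M]
  [IsScalarTower k k[X] M] {Q : Type*} [AddCommGroup Q] [Module k Q] [Module k[X] Q]
  [IsScalarTower k k[X] Q]

/-- The pairing `⟨f, u⟩_s ∈ k` at a scalar `s`. -/
def pairAt (s : k) : ConformalDual k M →ₗ[k] M →ₗ[k] k :=
  (pair k).compr₂ (Polynomial.leval s)

lemma pairAt_def (s : k) (f : ConformalDual k M) (u : M) :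
    pairAt s f u = (pair k f u).eval s := rfl

lemma pairAt_del_right (s : k) (f : ConformalDual k M) (u : M) :
    pairAt s f (del k M u) = s • pairAt s f u := by
  simp [pairAt_def, pair_del]

lemma pairAt_del_left (s : k) (f : ConformalDual k M) (u : M) :
    pairAt s (del k (ConformalDual k M) f) u = (-s) • pairAt s f u := by
  rw [del_conformalDual]
  simp [pairAt_def, dualDel]

lemma ConformalDual.ext_pairAt [Infinite k] {f g : ConformalDual k M}
    (h : ∀ (s : k) u, pairAt s f u = pairAt s g u) : f = g :=
  ConformalDual.ext fun u => Polynomial.funext fun s => h s u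

lemma pairAt_evalScalar_skew (s t : k) (f : ConformalDual k M) (p : ℕ →₀ M) :
    pairAt t f (evalScalar M s (skew k M p)) = pairAt t f (evalScalar M (-s - t) p) :=
  map_evalScalar_skew (pairAt t f) t (pairAt_del_right t f) s p

/-- On the dual side of the pairing at `t`, `∂` acts by `-t` rather than `t`, so `-λ-∂` becomes `t -
s`. -/
lemma pairAt_evalScalar_skew_left (s t : k) (p : ℕ →₀ ConformalDual k M) (v : M) :
    pairAt t (evalScalar _ s (skew k (ConformalDual k M) p)) v =
      pairAt t (evalScalar _ (t - s) p) v := by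
  have h := map_evalScalar_skew ((pairAt t).flip v) (-t) (fun m => pairAt_del_left t m v) s p
  rwa [show -s - -t = t - s by ring] at h

/-- `⟨l*(a)_s f, v⟩_t = -⟨f, l(a)_s v⟩_{t-s}`. -/
lemma pairAt_dual_at' [Module.Finite k[X] M] (l : ConformalBilin k Q M M) (s t : k) (a : Q)
    (f : ConformalDual k M) (v : M) :
    pairAt t (l.dual.at' s a f) v = -pairAt (t - s) f (l.at' s a v) := by
  have h1 : mapPoly ((pair k).flip v) (l.dual.toLin a f) = -shiftPair f (l.toLin a v) := by
    refine Polynomial.ext fun n => ?_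
    rw [coeff_mapPoly, LinearMap.flip_apply, pair_dual, Polynomial.coeff_neg]
  have h2 := eval_mapPoly ((pair k).flip v) (l.dual.toLin a f) s
  rw [h1, Polynomial.eval_neg, LinearMap.flip_apply] at h2
  -- Evaluation of `k[λ, μ]` at `λ = s`, `μ = t`: the outer variable is `λ`, so it is replaced by
  -- the constant `s` first. The element `C X - X` goes to `t - s`.
  let h : k[X][X] →ₗ[k] k :=
    Polynomial.leval t ∘ₗ (Polynomial.leval (Polynomial.C s : k[X])).restrictScalars k
  have h3 := map_subst_of_semiconj (LinearMap.mulLeft k (Polynomial.X : k[X][X]))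
    ((Polynomial.aeval (Polynomial.C Polynomial.X - Polynomial.X : k[X][X])).toLinearMap ∘ₗ
      pair k f) h s (fun w => by simp [h]) (l.toLin a v)
  have h4 : ∀ q : k[X], h (Polynomial.aeval
      (Polynomial.C Polynomial.X - Polynomial.X : k[X][X]) q) = q.eval (t - s) := by
    intro q
    induction q using Polynomial.induction_on' with
    | add p q hp hq => simp only [map_add, hp, hq, Polynomial.eval_add]
    | monomial n c =>
      simp [h, Polynomial.aeval_monomial, Polynomial.algebraMap_apply]
  rw [pairAt_def, ConformalBilin.at'_def, ← h2, Polynomial.eval_neg]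
  refine congrArg Neg.neg (h3.trans (h4 _))

end DualEvaluation

/-! ### The Leibniz identity on `Q ⊕ Q^{*c}`. -/

namespace LDCA

variable {k : Type*} [Field k] {Q : Type*} [AddCommGroup Q] [Module k Q] [Module k[X] Q]
  [IsScalarTower k k[X] Q] [Module.Finite k[X] Q] (A : LDCA k Q)

lemma semidirectBracket_at'_fst (s : k) (u v : Q × ConformalDual k Q) :
    (A.semidirectBracket.at' s u v).1 = A.bracket.at' s u.1 v.1 := by
  simp only [ConformalBilin.at'_def, semidirectBracket, semidirect, LinearMap.mk₂_apply, map_add,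
    evalScalar_mapRange, Prod.fst_add, LinearMap.inl_apply, LinearMap.inr_apply, add_zero]

/-- `⟨a_s y, v⟩_t = -⟨y, a ◁_s v⟩_{t-s}` and
`⟨x_s b, v⟩_t = ⟨x, b ◁_{t-s} v + v ▷_{-t} b⟩_s` in `Q ⋉ Q^{*c}`. -/
lemma pairAt_semidirectBracket_at'_snd (s t : k) (p q : Q × ConformalDual k Q) (v : Q) :
    pairAt t (A.semidirectBracket.at' s p q).2 v =
      -pairAt (t - s) q.2 (A.lhd.at' s p.1 v) +
        (pairAt s p.2 (A.lhd.at' (t - s) q.1 v) + pairAt s p.2 (A.rhd.at' (-t) v q.1)) := by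
  have h : (A.semidirectBracket.at' s p q).2 = A.lhd.dual.at' s p.1 q.2 +
      evalScalar _ s (skew k (ConformalDual k Q)
        ((-A.lhd.dual + -A.rhd.rightMul.dual).toLin q.1 p.2)) := by
    simp only [ConformalBilin.at'_def, semidirectBracket, semidirect, LinearMap.mk₂_apply, map_add,
      evalScalar_mapRange, Prod.snd_add, LinearMap.inl_apply, LinearMap.inr_apply, zero_add]
  -- Inside the pairing at `s`, `∂` acts by `s`, so the skew substitution at `t - s` gives `-(t - s)
  -- - s = -t`.
  have hr : pairAt s p.2 (A.rhd.rightMul.at' (t - s) q.1 v) =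
      pairAt s p.2 (A.rhd.at' (-t) v q.1) := by
    refine (pairAt_evalScalar_skew (t - s) s p.2 (A.rhd.toLin v q.1)).trans ?_
    rw [show -(t - s) - s = -t by ring]
    rfl
  rw [h, map_add, LinearMap.add_apply, pairAt_dual_at', pairAt_evalScalar_skew_left,
    ← ConformalBilin.at'_def, ConformalBilin.add_at', ConformalBilin.neg_at',
    ConformalBilin.neg_at', map_add, map_neg, map_neg, LinearMap.add_apply, LinearMap.neg_apply,
    LinearMap.neg_apply, pairAt_dual_at', pairAt_dual_at', sub_sub_cancel, hr, neg_neg, neg_neg]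

theorem semidirectBracket_isLeibniz [Infinite k] : A.semidirectBracket.IsLeibniz := by
  refine ConformalBilin.isLeibniz_of_at' _ fun s t p q r => Prod.ext ?_ ?_
  · simp only [Prod.fst_add, semidirectBracket_at'_fst]
    exact A.bracket_bracket_at' s t p.1 q.1 r.1
  · refine ConformalDual.ext_pairAt fun u v => ?_
    obtain ⟨a, x⟩ := p
    obtain ⟨b, y⟩ := q
    obtain ⟨c, z⟩ := r
    simp only [Prod.snd_add, map_add, LinearMap.add_apply, pairAt_semidirectBracket_at'_snd,
      semidirectBracket_at'_fst]
    have e1 : u - s - t = u - t - s := by ring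
    have e2 : u - (s + t) = u - t - s := by ring
    have e3 : s + t - s = t := by ring
    have e4 : -(s + t) = -u + (u - t - s) := by ring
    -- The four arguments carry the parameters `s`, `t`, `u - t - s` and `-u`, with sum zero; each
    -- dual vector is paired at its own parameter, and the axioms are used at those of the remaining
    -- arguments. The three groups are the parts linear in `z`, `y` and `x`.
    have hz := congrArg (pairAt (u - t - s) z) (A.lhd_lhd_at' s t a b v)
    have hy₁ := congrArg (pairAt t y) (A.lhd_lhd_at' s (u - t - s) a c v)
    have hy₂ := congrArg (pairAt t y) (A.lhd_rhd_at' s (-u) a v c)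
    have hx₁ := congrArg (pairAt s x) (A.lhd_lhd_at' t (u - t - s) b c v)
    have hx₂ := congrArg (pairAt s x) (A.lhd_rhd_at' t (-u) b v c)
    -- The bracket `[[x, b], c]` also produces `(v ▷ c + c ◁ v) ▷ b`, which has no counterpart in
    -- the other terms and must vanish by itself.
    have hx₃ := congrArg (pairAt s x) (A.rhd_rhd_add_rhd_lhd_at' (-u) (u - t - s) v c b)
    rw [show s + (u - t - s) = u - t by ring] at hy₁
    rw [show t + (u - t - s) = u - s by ring] at hx₁
    rw [show s + -u = -(u - s) by ring] at hy₂
    rw [show t + -u = -(u - t) by ring] at hx₂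
    simp only [e1, e2, e3, e4, map_add, map_zero] at hz hy₁ hy₂ hx₁ hx₂ hx₃ ⊢
    linear_combination hy₁ + hy₂ - hz - hx₁ - hx₂ - hx₃

end LDCA

end LeibnizConformal

namespace LeibnizConformal

/-! ### Detecting the image of `∂₁ + ∂₂ + ∂₃`, and the coordinates of `[[r, r]]`. -/

section Separation

variable {k : Type*} [Field k]

/-- Tensor products of separating families of functionals are separating. -/
lemma eq_zero_of_map_tmul_eq_zero {M N : Type*} [AddCommGroup M] [Module k M]
    [AddCommGroup N] [Module k N] {α β : Type*} (F : α → M →ₗ[k] k) (G : β → N →ₗ[k] k)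
    (hF : ∀ m, (∀ i, F i m = 0) → m = 0) (hG : ∀ n, (∀ j, G j n = 0) → n = 0) (T : M ⊗[k] N)
    (h : ∀ i j, LinearMap.mul' k k (TensorProduct.map (F i) (G j) T) = 0) : T = 0 := by
  classical
  let c := Module.Basis.ofVectorSpace k N
  -- Contracting the first factor with `F i` leaves a vector of `N` killed by every `G j`. Its
  -- coordinates in the basis `c` are the values of `F i` on the coefficients of `T`, so those
  -- coefficients vanish too.
  have h1 : ∀ i, TensorProduct.lid k N (TensorProduct.map (F i) LinearMap.id T) = 0 := by
    refine fun i => hG _ fun j => ?_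
    rw [← h i j]
    refine LinearMap.congr_fun (f := G j ∘ₗ (TensorProduct.lid k N).toLinearMap ∘ₗ
      TensorProduct.map (F i) LinearMap.id) (g := LinearMap.mul' k k ∘ₗ
      TensorProduct.map (F i) (G j)) (TensorProduct.ext' fun m n => ?_) T
    simp
  apply (TensorProduct.equivFinsuppOfBasisRight c).injective
  rw [map_zero]
  refine Finsupp.ext fun n => hF _ fun i => ?_
  rw [← map_zero (c.coord n), ← h1 i]
  refine LinearMap.congr_fun (f := F i ∘ₗ Finsupp.lapply n ∘ₗ
    (TensorProduct.equivFinsuppOfBasisRight c).toLinearMap) (g := c.coord n ∘ₗ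
    (TensorProduct.lid k N).toLinearMap ∘ₗ TensorProduct.map (F i) LinearMap.id)
    (TensorProduct.ext' fun m n => ?_) T
  simp [mul_comm]

variable {L : Type*} [AddCommGroup L] [Module k L] [Module k[X] L] [IsScalarTower k k[X] L]
  {κ : Type*} (E : Module.Basis κ k[X] L)

/-- The value at `∂ = s` of the `J`-th coordinate with respect to a `k[∂]`-basis. -/
def coordAt (J : κ) (s : k) : L →ₗ[k] k :=
  Polynomial.leval s ∘ₗ (E.coord J).restrictScalars k

lemma coordAt_apply (J : κ) (s : k) (x : L) : coordAt E J s x = (E.repr x J).eval s := rfl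

lemma coordAt_del (J : κ) (s : k) (x : L) :
    coordAt E J s (del k L x) = s * coordAt E J s x := by
  simp [coordAt_apply, del]

lemma coordAt_basis [DecidableEq κ] (I J : κ) (s : k) :
    coordAt E I s (E J) = if I = J then 1 else 0 := by
  rw [coordAt_apply, E.repr_self, Finsupp.single_apply]
  simp only [eq_comm (a := I)]
  split_ifs <;> simp

lemma eq_zero_of_coordAt [Infinite k] (x : L) (h : ∀ J s, coordAt E J s x = 0) : x = 0 := by
  apply E.repr.injective
  rw [map_zero]
  exact Finsupp.ext fun J => Polynomial.funext fun s => (h J s).trans Polynomial.eval_zero.symm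

/-- The functional on `L ⊗ L ⊗ L` that multiplies the values of three functionals. -/
def tripleFun (f g h : L →ₗ[k] k) : L ⊗[k] (L ⊗[k] L) →ₗ[k] k :=
  LinearMap.mul' k k ∘ₗ TensorProduct.map f (LinearMap.mul' k k ∘ₗ TensorProduct.map g h)

@[simp] lemma tripleFun_tmul (f g h : L →ₗ[k] k) (x y z : L) :
    tripleFun f g h (x ⊗ₜ (y ⊗ₜ z)) = f x * (g y * h z) := by
  simp [tripleFun]

variable {f g h : L →ₗ[k] k} {s₁ s₂ s₃ : k}

lemma tripleFun_del₁ (hf : ∀ x, f (del k L x) = s₁ * f x) (T : L ⊗[k] (L ⊗[k] L)) :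
    tripleFun f g h (del₁ k L T) = s₁ • tripleFun f g h T := by
  refine LinearMap.congr_fun (f := tripleFun f g h ∘ₗ del₁ k L) (g := s₁ • tripleFun f g h)
    (TensorProduct.ext_threefold' fun x y z => ?_) T
  simp [del₁, hf, mul_assoc]

lemma tripleFun_del₂ (hg : ∀ x, g (del k L x) = s₂ * g x) (T : L ⊗[k] (L ⊗[k] L)) :
    tripleFun f g h (del₂ k L T) = s₂ • tripleFun f g h T := by
  refine LinearMap.congr_fun (f := tripleFun f g h ∘ₗ del₂ k L) (g := s₂ • tripleFun f g h)
    (TensorProduct.ext_threefold' fun x y z => ?_) T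
  simp only [LinearMap.comp_apply, LinearMap.smul_apply, del₂, TensorProduct.map_tmul,
    LinearMap.id_apply, tripleFun_tmul, hg, smul_eq_mul]
  ring

lemma tripleFun_del₃ (hh : ∀ x, h (del k L x) = s₃ * h x) (T : L ⊗[k] (L ⊗[k] L)) :
    tripleFun f g h (del₃ k L T) = s₃ • tripleFun f g h T := by
  refine LinearMap.congr_fun (f := tripleFun f g h ∘ₗ del₃ k L) (g := s₃ • tripleFun f g h)
    (TensorProduct.ext_threefold' fun x y z => ?_) T
  simp only [LinearMap.comp_apply, LinearMap.smul_apply, del₃, TensorProduct.map_tmul,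
    LinearMap.id_apply, tripleFun_tmul, hh, smul_eq_mul]
  ring

/-- `S ↦ ∑_K S_K ⊗ E_K`. -/
def sumTmulBasis [Fintype κ] : (κ → L ⊗[k] L) →ₗ[k] L ⊗[k] (L ⊗[k] L) :=
  ∑ K, (TensorProduct.assoc k L L L).toLinearMap ∘ₗ
    (TensorProduct.mk k (L ⊗[k] L) L).flip (E K) ∘ₗ LinearMap.proj K

lemma sumTmulBasis_apply [Fintype κ] (S : κ → L ⊗[k] L) :
    sumTmulBasis E S = ∑ K, TensorProduct.assoc k L L L (S K ⊗ₜ E K) := by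
  simp [sumTmulBasis]

/-- Modulo the image of `∂₁ + ∂₂ + ∂₃`, the operator `∂₃` can be eliminated. -/
lemma range_del_sup_range_sumTmulBasis [Fintype κ] :
    LinearMap.range (del₁ k L + del₂ k L + del₃ k L) ⊔ LinearMap.range (sumTmulBasis E) = ⊤ := by
  classical
  set N := LinearMap.range (del₁ k L + del₂ k L + del₃ k L) ⊔ LinearMap.range (sumTmulBasis E)
  have hk : ∀ (c : k) (z : L), (Polynomial.C c : k[X]) • z = c • z := fun c z => by
    rw [← Polynomial.algebraMap_eq, algebraMap_smul]
  -- Modulo the image, `x ⊗ y ⊗ ∂z` equals `-∂x ⊗ y ⊗ z - x ⊗ ∂y ⊗ z`. Since `x` and `y` change,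
  -- membership is assumed for all of them at once.
  have hX : ∀ z : L, (∀ x y : L, x ⊗ₜ[k] (y ⊗ₜ[k] z) ∈ N) →
      ∀ x y : L, x ⊗ₜ[k] (y ⊗ₜ[k] del k L z) ∈ N := by
    intro z hz x y
    have h0 : (del₁ k L + del₂ k L + del₃ k L) (x ⊗ₜ[k] (y ⊗ₜ[k] z)) ∈ N :=
      Submodule.mem_sup_left ⟨_, rfl⟩
    simp only [LinearMap.add_apply, del₁, del₂, del₃, TensorProduct.map_tmul,
      LinearMap.id_apply] at h0
    exact (Submodule.add_mem_iff_right N (N.add_mem (hz _ _) (hz _ _))).mp h0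
  have hpoly : ∀ (p : k[X]) (z : L), (∀ x y : L, x ⊗ₜ[k] (y ⊗ₜ[k] z) ∈ N) →
      ∀ x y : L, x ⊗ₜ[k] (y ⊗ₜ[k] (p • z)) ∈ N := by
    intro p
    induction p using Polynomial.induction_on with
    | C c =>
      intro z hz x y
      rw [hk, TensorProduct.tmul_smul, TensorProduct.tmul_smul]
      exact N.smul_mem _ (hz x y)
    | add p q hp hq =>
      intro z hz x y
      rw [add_smul, TensorProduct.tmul_add, TensorProduct.tmul_add]
      exact N.add_mem (hp z hz x y) (hq z hz x y)
    | monomial n c ih =>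
      intro z hz x y
      rw [pow_succ, ← mul_assoc, mul_smul]
      exact ih (del k L z) (hX z hz) x y
  have hall : ∀ z x y : L, x ⊗ₜ[k] (y ⊗ₜ[k] z) ∈ N := by
    intro z x y
    rw [← E.sum_repr z, TensorProduct.tmul_sum, TensorProduct.tmul_sum]
    refine N.sum_mem fun K _ => hpoly _ _ (fun x y => ?_) x y
    refine Submodule.mem_sup_right ⟨Pi.single K (x ⊗ₜ y), ?_⟩
    rw [sumTmulBasis_apply, Finset.sum_eq_single K]
    · simp
    · intro J _ hJ
      rw [Pi.single_eq_of_ne hJ, TensorProduct.zero_tmul, map_zero]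
    · simp
  rw [eq_top_iff]
  intro T _
  induction T using TensorProduct.induction_on with
  | zero => exact N.zero_mem
  | add T T' hT hT' => exact N.add_mem (hT trivial) (hT' trivial)
  | tmul x w =>
    induction w using TensorProduct.induction_on with
    | zero => rw [TensorProduct.tmul_zero]; exact N.zero_mem
    | add w w' hw hw' =>
      rw [TensorProduct.tmul_add]
      exact N.add_mem (hw trivial) (hw' trivial)
    | tmul y z => exact hall z x y

/-- Coordinates at scalars with sum zero detect the image of `∂₁ + ∂₂ + ∂₃`. -/
lemma mem_range_del_of_tripleFun [Infinite k] [Fintype κ] (T : L ⊗[k] (L ⊗[k] L))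
    (hT : ∀ (I J K : κ) (s₁ s₂ s₃ : k), s₁ + s₂ + s₃ = 0 →
      tripleFun (coordAt E I s₁) (coordAt E J s₂) (coordAt E K s₃) T = 0) :
    T ∈ LinearMap.range (del₁ k L + del₂ k L + del₃ k L) := by
  classical
  obtain ⟨_, ⟨R, rfl⟩, _, ⟨S, rfl⟩, rfl⟩ := Submodule.mem_sup.mp
    ((range_del_sup_range_sumTmulBasis (k := k) E).symm ▸ Submodule.mem_top : T ∈ _)
  suffices hS : S = 0 by
    rw [hS, map_zero, add_zero]
    exact ⟨R, rfl⟩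
  funext K
  refine eq_zero_of_map_tmul_eq_zero (fun i : κ × k => coordAt E i.1 i.2)
    (fun i : κ × k => coordAt E i.1 i.2) (fun x hx => eq_zero_of_coordAt E x fun J s => hx (J, s))
    (fun x hx => eq_zero_of_coordAt E x fun J s => hx (J, s)) _ ?_
  rintro ⟨I, s⟩ ⟨J, t⟩
  -- The third parameter is forced to be `-s - t`, but nothing is lost: the coordinates of a basis
  -- vector `E K` are constants. The functional kills the image, as the total `∂` acts by zero, and
  -- so it reads off the coordinates of `S K` at arbitrary `s`, `t`.
  have h0 := hT I J K s t (-s - t) (by ring)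
  have h1 : ∀ (w : L ⊗[k] L) (z : L), tripleFun (coordAt E I s) (coordAt E J t)
      (coordAt E K (-s - t)) (TensorProduct.assoc k L L L (w ⊗ₜ z)) =
      LinearMap.mul' k k (TensorProduct.map (coordAt E I s) (coordAt E J t) w) *
        coordAt E K (-s - t) z := by
    intro w z
    induction w using TensorProduct.induction_on with
    | zero => simp
    | add w w' hw hw' => simp only [TensorProduct.add_tmul, map_add, hw, hw', add_mul]
    | tmul x y => simp [mul_assoc]
  rw [map_add, LinearMap.add_apply, LinearMap.add_apply, map_add, map_add,
    tripleFun_del₁ (coordAt_del E I s), tripleFun_del₂ (coordAt_del E J t),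
    tripleFun_del₃ (coordAt_del E K (-s - t)), ← add_smul, ← add_smul,
    show s + t + (-s - t) = 0 by ring, zero_smul, zero_add, sumTmulBasis_apply, map_sum] at h0
  simpa [h1, coordAt_basis] using h0

/-- Under the triple functional `∂₁` and `∂₂` act by `s₁` and `s₂`, and the substitution `μ = -∂₁ -
∂₂` becomes evaluation at `s₃` because the parameters sum to zero. -/
lemma tripleFun_ybTerm (br : ConformalBilin k L L L) (hf : ∀ x, f (del k L x) = s₁ * f x)
    (hg : ∀ x, g (del k L x) = s₂ * g x) (hs : s₁ + s₂ + s₃ = 0) (a b a' b' : L) :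
    tripleFun f g h (ybTerm br a b a' b') =
      f (br.at' s₂ a a') * (g b * h b') + f a * (g a' * h (br.at' s₂ b' b))
        - f a * (g (br.at' s₁ b a') * h b') - f a * (g (br.at' s₃ a' b) * h b') := by
  have h3 : ∀ T, tripleFun f g h ((-del₁ k L - del₂ k L) T) = s₃ • tripleFun f g h T := by
    intro T
    rw [LinearMap.sub_apply, LinearMap.neg_apply, map_sub, map_neg, tripleFun_del₁ hf,
      tripleFun_del₂ hg, ← neg_smul, ← sub_smul, show -s₁ - s₂ = s₃ by linear_combination -hs]
  rw [ybTerm, map_sub, map_sub, map_add, map_subst_of_semiconj _ _ _ _ (tripleFun_del₂ hg),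
    map_subst_of_semiconj _ _ _ _ (tripleFun_del₂ hg),
    map_subst_of_semiconj _ _ _ _ (tripleFun_del₁ hf), map_subst_of_semiconj _ _ _ _ h3]
  simp only [slot₁, slot₂, slot₃, LinearMap.comp_apply, LinearMap.flip_apply,
    TensorProduct.mk_apply, tripleFun_tmul, ConformalBilin.at'_def]

/-- The value on `[[r, r]]` for `r = ∑_J E_J ⊗ E_{σ J}`, with `σ` an involution. -/
lemma tripleFun_ybBilin [Fintype κ] (σ : κ → κ) (hσ : Function.Involutive σ)
    (br : ConformalBilin k L L L) (hs : s₁ + s₂ + s₃ = 0) (I J K : κ) :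
    tripleFun (coordAt E I s₁) (coordAt E J s₂) (coordAt E K s₃)
      (ybBilin br (∑ J, E J ⊗ₜ[k] E (σ J)) (∑ J, E J ⊗ₜ[k] E (σ J))) =
    coordAt E I s₁ (br.at' s₂ (E (σ J)) (E (σ K))) +
      coordAt E K s₃ (br.at' s₂ (E (σ J)) (E (σ I))) -
      coordAt E J s₂ (br.at' s₁ (E (σ I)) (E (σ K))) -
      coordAt E J s₂ (br.at' s₃ (E (σ K)) (E (σ I))) := by
  classical
  -- This puts every Kronecker delta into a form that isolates the summation index, so that both
  -- sums collapse.
  have hσ' : ∀ A B : κ, A = σ B ↔ σ A = B := fun A B =>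
    ⟨fun h => by rw [h, hσ], fun h => by rw [← h, hσ]⟩
  simp only [map_sum, LinearMap.sum_apply, ybBilin_tmul,
    tripleFun_ybTerm br (coordAt_del E I s₁) (coordAt_del E J s₂) hs, coordAt_basis, hσ',
    Finset.sum_add_distrib, Finset.sum_sub_distrib, mul_ite, ite_mul, mul_one, mul_zero, one_mul,
    zero_mul, Finset.sum_ite_irrel, Finset.sum_ite_eq, Finset.mem_univ, if_true, Finset.sum_const_zero]

end Separation

/-! ### The form on `Q ⊕ Q^{*c}` and its compatibility with the bracket. -/

section Pairing

variable {k : Type*} [Field k] {Q : Type*} [AddCommGroup Q] [Module k Q] [Module k[X] Q]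
  [IsScalarTower k k[X] Q] {ι : Type*} [Fintype ι] (b : Module.Basis ι k[X] Q)

lemma repr_eq_pair_dualBasis (i : ι) (a : Q) : b.repr a i = pair k (dualBasis b i) a := by
  classical
  conv_rhs => rw [← b.sum_repr a, map_sum]
  simp [apply_poly_smul _ (pair_del k (dualBasis b i)), pair_dualBasis]

lemma dualBasis_repr (i : ι) (x : ConformalDual k Q) :
    (dualBasis b).repr x i = (pair k x (b i)).comp (-Polynomial.X) := rfl

/-- The symmetric form `⟨y, a⟩_s + ⟨x, b⟩_{-s}` of `a + x` and `b + y`. -/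
def dualForm (s : k) (u v : Q × ConformalDual k Q) : k :=
  pairAt s v.2 u.1 + pairAt (-s) u.2 v.1

/-- The basis and its swap are dual to each other for `dualForm`. The sign in its second term
matches the action of `∂` on `Q^{*c}` by `-λ`. -/
lemma coordAt_prod_dualBasis (J : ι ⊕ ι) (s : k) (w : Q × ConformalDual k Q) :
    coordAt (b.prod (dualBasis b)) J s w = dualForm s w (b.prod (dualBasis b) J.swap) := by
  cases J with
  | inl i =>
    rw [coordAt_apply, Module.Basis.prod_repr_inl, repr_eq_pair_dualBasis]
    simp [dualForm, Module.Basis.prod_apply, pairAt_def]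
  | inr i =>
    rw [coordAt_apply, Module.Basis.prod_repr_inr, dualBasis_repr]
    simp [dualForm, Module.Basis.prod_apply, pairAt_def]

lemma canonicalTensor_eq_sum : canonicalTensor b =
    ∑ J : ι ⊕ ι, b.prod (dualBasis b) J ⊗ₜ[k] b.prod (dualBasis b) J.swap := by
  rw [Fintype.sum_sum_type, canonicalTensor, Finset.sum_add_distrib, add_comm]
  simp [Module.Basis.prod_apply]

lemma comm_canonicalTensor :
    TensorProduct.comm k _ _ (canonicalTensor b) = canonicalTensor b := by
  simp [canonicalTensor, map_sum, add_comm]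

/-- This is the Yang–Baxter expression with `u`, `v`, `w` as the three test vectors. Moving the dual
actions across the pairing turns every term into a dual component of one vector evaluated on a
product of the `Q`-components of the other two. Since the parameters sum to zero, these terms agree
and cancel. -/
lemma LDCA.dualForm_semidirectBracket [Module.Finite k[X] Q] (A : LDCA k Q) {s₁ s₂ s₃ : k}
    (hs : s₁ + s₂ + s₃ = 0) (u v w : Q × ConformalDual k Q) :
    dualForm s₁ (A.semidirectBracket.at' s₂ v w) u + dualForm s₃ (A.semidirectBracket.at' s₂ v u) w
      - dualForm s₂ (A.semidirectBracket.at' s₁ u w) v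
      - dualForm s₂ (A.semidirectBracket.at' s₃ w u) v = 0 := by
  have e1 : -s₁ - s₂ = s₃ := by linear_combination -hs
  have e2 : -s₃ - s₂ = s₁ := by linear_combination -hs
  have e3 : -s₂ - s₁ = s₃ := by linear_combination -hs
  have e4 : -s₂ - s₃ = s₁ := by linear_combination -hs
  simp only [dualForm, A.semidirectBracket_at'_fst, A.pairAt_semidirectBracket_at'_snd,
    A.bracket_at', e1, e2, e3, e4, map_add, neg_neg]
  ring

end Pairing

end LeibnizConformal

end

theorem theorem4p16 {k : Type*} [Field k] [CharZero k] {Q : Type*} [AddCommGroup Q] [Module k Q]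
    [Module (Polynomial k) Q] [IsScalarTower k (Polynomial k) Q] [Module.Finite (Polynomial k) Q]
    (A : LeibnizConformal.LDCA k Q)
    {ι : Type*} [Fintype ι] (b : Module.Basis ι (Polynomial k) Q) :
    A.semidirectBracket.IsLeibniz ∧
      LeibnizConformal.IsCLCYBESolution A.semidirectBracket
        (LeibnizConformal.canonicalTensor b) ∧
      TensorProduct.comm k _ _ (LeibnizConformal.canonicalTensor b) =
        LeibnizConformal.canonicalTensor b := by
  refine ⟨A.semidirectBracket_isLeibniz, ?_, LeibnizConformal.comm_canonicalTensor b⟩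
  refine LeibnizConformal.mem_range_del_of_tripleFun
    (b.prod (LeibnizConformal.dualBasis b)) _ fun I J K s₁ s₂ s₃ hs => ?_
  rw [LeibnizConformal.canonicalTensor_eq_sum,
    LeibnizConformal.tripleFun_ybBilin _ Sum.swap Sum.swap_swap _ hs]
  simp only [LeibnizConformal.coordAt_prod_dualBasis]
  exact A.dualForm_semidirectBracket hs _ _ _
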